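/- Let $p$ be a prime with $p\neq 2,3,7$ and let $q=2^p$. Let $\mathrm{Tr}$ be the absolute trace $\mathrm{GF}(q)\to\mathrm{GF}(2)$. For $\alpha,\beta,\lambda\in\mathrm{GF}(q)$ with $\mathrm{Tr}(\alpha\beta)=1$ and $\lambda\neq 0$ let $F_{\alpha,\beta,\lambda}$ be the conic $\alpha x^2+xy+\beta y^2+\lambda z^2=0$ of $\mathrm{PG}(2,q)$; its nucleus is $(0,0,1)$. For $\lambda\ne\lambda'$ put $$F_{\alpha,\beta,\lambda}\oplus F_{\alpha',\beta',\lambda'}=F_{\alpha'',\beta'',\lambda+\lambda'},\qquad \alpha''=\frac{\alpha\lambda+\alpha'\lambda'}{\lambda+\lambda'},\quad \beta''=\frac{\beta\lambda+\beta'\lambda'}{\lambda+\lambda'}.$$ A set $\mathcal C$ of such conics is closed if, for any two distinct members of $\mathcal C$, their composition $\oplus$ is defined (that is, their parameters $\lambda,\lambda'$ are distinct) and again lies in $\mathcal C$ (in particular $\mathrm{Tr}(\alpha''\beta'')=1$). Up to collineations of $\mathrm{PG}(2,q)$, a Mathon $d$-arc is the union of $\{(0,0,1)\}$ and all conics of a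 closed set of $d-1$ conics, and an arc of Denniston type is the union of $\{(0,0,1)\}$ and the conics $F_{\alpha,1,\lambda}$, $\lambda\in A\setminus\{0\}$, for some $\alpha$ with $\mathrm{Tr}(\alpha)=1$ and some additive subgroup $A$ of $\mathrm{GF}(q)$. A Mathon $d$-arc is proper if it is not of Denniston type. Then, for every proper Mathon $8$-arc $\mathcal K$ in $\mathrm{PG}(2,2^p)$, the full collineation stabilizer $\mathrm{Aut}(\mathcal K)$, i.e. the setwise stabilizer of $\mathcal K$ in $\mathrm{P\Gamma L}(3,2^p)$, is cyclic of order $2$. -/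

import Mathlib

open scoped Pointwise LinearAlgebra.Projectivization

namespace MathonArcs

/-- The points of the Desarguesian projective plane `PG(2, F)`: the one-dimensional subspaces
of `F ^ 3`. -/
abbrev Point (F : Type*) [Field F] : Type _ := ℙ F (Fin 3 → F)

/-- The permutation `g` of the points is induced by the semilinear map `x ↦ M x ^ σ`. -/
def IsInducedBy {F : Type*} [Field F] (g : Equiv.Perm (Point F))
    (M : GL (Fin 3) F) (σ : F ≃+* F) : Prop :=
  ∀ (v : Fin 3 → F) (hv : v ≠ 0), ∃ hw : M.1.mulVec (fun i => σ (v i)) ≠ 0,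
    g (Projectivization.mk F v hv) = Projectivization.mk F (M.1.mulVec (fun i => σ (v i))) hw

lemma isInducedBy_one {F : Type*} [Field F] :
    IsInducedBy (1 : Equiv.Perm (Point F)) 1 (RingEquiv.refl F) := by
  intro v hv
  refine ⟨by simpa using hv, by simp⟩

lemma IsInducedBy.mul {F : Type*} [Field F] {g h : Equiv.Perm (Point F)}
    {M N : GL (Fin 3) F} {σ τ : F ≃+* F} (hg : IsInducedBy g M σ) (hh : IsInducedBy h N τ) :
    IsInducedBy (g * h) (M * Matrix.GeneralLinearGroup.map (σ : F →+* F) N) (τ.trans σ) := by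
  intro v hv
  obtain ⟨h1, e1⟩ := hh v hv
  obtain ⟨h2, e2⟩ := hg _ h1
  have key : (M * Matrix.GeneralLinearGroup.map (σ : F →+* F) N).1.mulVec
      (fun i => (τ.trans σ) (v i)) =
      M.1.mulVec (fun i => σ (N.1.mulVec (fun j => τ (v j)) i)) := by
    have : (fun i => σ (N.1.mulVec (fun j => τ (v j)) i)) =
        (Matrix.GeneralLinearGroup.map (σ : F →+* F) N).1.mulVec
          (fun i => (τ.trans σ) (v i)) := by
      funext i
      simp [Matrix.mulVec, dotProduct, map_sum]
    rw [this, Matrix.mulVec_mulVec]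
    rfl
  refine ⟨by rw [key]; exact h2, ?_⟩
  rw [Equiv.Perm.mul_apply, e1, e2]
  congr 1
  exact key.symm

lemma IsInducedBy.inv {F : Type*} [Field F] {g : Equiv.Perm (Point F)}
    {M : GL (Fin 3) F} {σ : F ≃+* F} (hg : IsInducedBy g M σ) :
    IsInducedBy g⁻¹ (Matrix.GeneralLinearGroup.map (σ.symm : F →+* F) M⁻¹) σ.symm := by
  intro v hv
  set w : Fin 3 → F := (Matrix.GeneralLinearGroup.map (σ.symm : F →+* F) M⁻¹).1.mulVec
    (fun i => σ.symm (v i)) with hwdef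
  have key : M.1.mulVec (fun i => σ (w i)) = v := by
    have : (fun i => σ (w i)) = (M⁻¹).1.mulVec v := by
      rw [hwdef]
      generalize M⁻¹ = N
      funext i
      simp [Matrix.mulVec, dotProduct, map_sum]
    rw [this, Matrix.mulVec_mulVec]
    have h1 : M.1 * (M⁻¹).1 = 1 := by
      rw [← Units.val_mul, mul_inv_cancel, Units.val_one]
    rw [h1, Matrix.one_mulVec]
  have hw : w ≠ 0 := by
    intro h0
    apply hv
    rw [← key, h0]
    simp only [Pi.zero_apply, map_zero]
    exact Matrix.mulVec_zero _
  refine ⟨hw, ?_⟩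
  obtain ⟨h2, e2⟩ := hg w hw
  rw [Equiv.Perm.inv_eq_iff_eq, e2]
  congr 1
  exact key.symm

/-- The full collineation group `PΓL(3, F)` of `PG(2, F)`, acting faithfully on the points:
all permutations of the points of the form `x ↦ M x ^ σ`, with `M` an invertible matrix and
`σ` a field automorphism. -/
def collineationGroup (F : Type*) [Field F] : Subgroup (Equiv.Perm (Point F)) where
  carrier := {g | ∃ (M : GL (Fin 3) F) (σ : F ≃+* F), IsInducedBy g M σ}
  one_mem' := ⟨1, RingEquiv.refl F, isInducedBy_one⟩
  mul_mem' := by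
    rintro g h ⟨M, σ, hg⟩ ⟨N, τ, hh⟩
    exact ⟨_, _, hg.mul hh⟩
  inv_mem' := by
    rintro g ⟨M, σ, hg⟩
    exact ⟨_, _, hg.inv⟩

/-- `Aut(K)`: the setwise stabilizer of the point set `K` in the full collineation group. -/
def collineationStabilizer {F : Type*} [Field F] (K : Set (Point F)) :
    Subgroup (collineationGroup F) :=
  MulAction.stabilizer (collineationGroup F) K

/-- Parameters `(α, β, lam)` of the curve `α x² + x y + β y² + lam z² = 0`. -/
@[ext]
structure ConicParam (F : Type*) where
  α : F
  β : F
  lam : F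

/-- The point set `F_{α,β,lam}` of `α x² + x y + β y² + lam z² = 0`. -/
def ConicParam.points {F : Type*} [Field F] (c : ConicParam F) : Set (Point F) :=
  {P | ∃ (v : Fin 3 → F) (hv : v ≠ 0), P = Projectivization.mk F v hv ∧
    c.α * v 0 ^ 2 + v 0 * v 1 + c.β * v 1 ^ 2 + c.lam * v 2 ^ 2 = 0}

/-- Mathon's composition of two curves (meaningful for `c.lam ≠ c'.lam`, in characteristic 2). -/
def ConicParam.comp {F : Type*} [Field F] (c c' : ConicParam F) : ConicParam F where
  α := (c.α * c.lam + c'.α * c'.lam) / (c.lam + c'.lam)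
  β := (c.β * c.lam + c'.β * c'.lam) / (c.lam + c'.lam)
  lam := c.lam + c'.lam

/-- The point `(0, 0, 1)`, the common nucleus of all conics `F_{α,β,lam}`. -/
def nucleus (F : Type*) [Field F] : Point F :=
  Projectivization.mk F (Pi.single 2 1 : Fin 3 → F) (by simp)

/-- Closed sets of conics: sets of conics `F_{α,β,lam}` with `Tr(α β) = 1` and `lam ≠ 0` such that
for any two distinct members the composition is defined and is again a member. -/
structure IsClosedConicSet {F : Type*} [Field F] [Algebra (ZMod 2) F]
    (C : Set (ConicParam F)) : Prop where
  trace_eq_one : ∀ c ∈ C, Algebra.trace (ZMod 2) F (c.α * c.β) = 1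
  lam_ne_zero : ∀ c ∈ C, c.lam ≠ 0
  lam_ne : ∀ c ∈ C, ∀ c' ∈ C, c ≠ c' → c.lam ≠ c'.lam
  comp_mem : ∀ c ∈ C, ∀ c' ∈ C, c ≠ c' → c.comp c' ∈ C

/-- The union of the conics of `C` together with their common nucleus. -/
def arcOf {F : Type*} [Field F] (C : Set (ConicParam F)) : Set (Point F) :=
  {nucleus F} ∪ ⋃ c ∈ C, c.points

/-- `K` is a Mathon arc of degree `d` (a Mathon `d`-arc): up to a change of coordinates,
it is the arc of a closed set of `d - 1` conics. -/
def IsMathonArc {F : Type*} [Field F] [Algebra (ZMod 2) F] (d : ℕ) (K : Set (Point F)) : Prop :=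
  ∃ C : Set (ConicParam F), IsClosedConicSet C ∧ C.ncard + 1 = d ∧
    ∃ g ∈ collineationGroup F, K = g '' arcOf C

/-- `K` is of Denniston type: up to a change of coordinates, it consists of the point `(0, 0, 1)`
and the conics `α x² + x y + y² + lam z² = 0`, `lam ∈ A \ {0}`, of the standard pencil, for some
`α` of absolute trace `1` and some additive subgroup `A` of the field. -/
def IsDennistonArc {F : Type*} [Field F] [Algebra (ZMod 2) F] (K : Set (Point F)) : Prop :=
  ∃ (α : F) (A : AddSubgroup F), Algebra.trace (ZMod 2) F α = 1 ∧
    ∃ g ∈ collineationGroup F,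
      K = g '' arcOf {c : ConicParam F | c.α = α ∧ c.β = 1 ∧ c.lam ∈ A ∧ c.lam ≠ 0}

/-- A proper Mathon `d`-arc: a Mathon `d`-arc that is not of Denniston type. -/
def IsProperMathonArc {F : Type*} [Field F] [Algebra (ZMod 2) F] (d : ℕ)
    (K : Set (Point F)) : Prop :=
  IsMathonArc d K ∧ ¬ IsDennistonArc K

end MathonArcs

/-!
Write `Q_c = α x² + x y + β y² + lam z²` for a member `c` of a closed set `C` of seven conics. The
parameters `lam`, together with `0`, form an additive group `A` of order `8`, on which `α lam` and
`β lam` are additive functions of `lam`.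

*An involution exists.* The four additive functions `α lam`, `lam`, `β lam`, `lam²` on `A ≅ GF(2)³`
are linearly dependent, so there is a relation `u α + v + w β = k lam` on `C`. The trace condition
excludes `v² = u w` (`sq_ne_mul_of_relation`), so it can be scaled to
`w₁² α + (1 + w₁ w₂) + w₂² β = e² lam` (`exists_normalized_relation`), which says exactly that the
transvection of `(x, y)` along `(w₁, w₂)`, combined with `z ↦ z + e (w₂ x + w₁ y)`, preserves every
`Q_c`.

*There is nothing else.* Suppose `x ↦ M x ^ σ` stabilises the arc. A rationally parametrised conic
of the arc is mapped into a union of seven conics and a point, so that, the field having at least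
`32` elements, a degree count shows that it is mapped to one of the seven (`exists_image_conic`).
Hence `M` fixes the nucleus and `lam ↦ k lam ^ σ` permutes `A` for some scalar `k`. The `p`-th
power of this map is a scalar of order dividing `7` and `2 ^ p - 1`, hence trivial; as `p` does not
divide `|GL(3, 2)| = 168`, the map itself is trivial on `A`, which gives `σ = 1` and `k = 1`
(`eq_refl_and_eq_one_of_forall_mem`), and so all seven conics are fixed. Comparing the coefficients
of `x²` and of `y²` in `Q_c ∘ M = Q_c` gives two more relations on `C`. Two independent relations
would express `α` and `β` as affine functions of `lam`, and the arc would be of Denniston type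
(`isDennistonArc_of_affine`); for a proper arc both are thus multiples of the normalised one, and
then only the identity and the involution remain (`entries_eq_of_relations`).
-/

namespace MathonArcs

/-! ### Semilinear maps preserving a small additive subgroup -/

section Semilinear

variable {F : Type*} [Field F] [Finite F]

/-- If multiplication by `N` preserves a set of seven non-zero elements, comparing products gives
`N ^ 7 = 1`; this forces `N = 1` because `7 = 2 ^ 3 - 1` is coprime to `2 ^ p - 1`. -/
lemma eq_one_of_forall_mul_mem {p : ℕ} (hp : p.Prime) (hp3 : p ≠ 3) (hF : Nat.card F = 2 ^ p)
    (A : AddSubgroup F) (hA : Nat.card A = 8) {N : F} (hN : N ≠ 0)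
    (h : ∀ x ∈ A, N * x ∈ A) : N = 1 := by
  classical
  have := Fintype.ofFinite F
  let S : Finset F := (A : Set F).toFinset.erase 0
  have hmem : ∀ x, x ∈ S ↔ x ≠ 0 ∧ x ∈ A := by simp [S]
  have hcard : S.card = 7 := by
    have h8 : (A : Set F).toFinset.card = 8 := by
      rw [← Set.ncard_eq_toFinset_card']
      exact hA
    simp only [S]
    rw [Finset.card_erase_of_mem (by simp), h8]
  have himg : S.image (N * ·) = S := by
    apply Finset.eq_of_subset_of_card_le
    · intro y hy
      obtain ⟨x, hx, rfl⟩ := Finset.mem_image.1 hy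
      rw [hmem] at hx ⊢
      exact ⟨mul_ne_zero hN hx.1, h x hx.2⟩
    · rw [Finset.card_image_of_injective _ (mul_right_injective₀ hN)]
  have hprod : ∏ x ∈ S, x ≠ 0 := Finset.prod_ne_zero_iff.2 fun x hx => ((hmem x).1 hx).1
  have h7 : N ^ 7 = 1 := by
    have h1 : ∏ x ∈ S, N * x = ∏ x ∈ S, x := by
      conv_rhs => rw [← himg]
      rw [Finset.prod_image fun x _ y _ hxy => mul_right_injective₀ hN hxy]
    rw [Finset.prod_mul_distrib, Finset.prod_const, hcard] at h1
    exact mul_right_cancel₀ hprod (h1.trans (one_mul _).symm)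
  have hq : N ^ (2 ^ p - 1) = 1 := by
    have := FiniteField.pow_card_sub_one_eq_one N hN
    rwa [← Nat.card_eq_fintype_card, hF] at this
  have hgcd : Nat.gcd (2 ^ 3 - 1) (2 ^ p - 1) = 1 := by
    rw [Nat.pow_sub_one_gcd_pow_sub_one, (Nat.coprime_primes Nat.prime_three hp).2 hp3.symm,
      pow_one]
  rw [← orderOf_eq_one_iff, ← Nat.dvd_one, ← hgcd]
  exact Nat.dvd_gcd (orderOf_dvd_of_pow_eq_one h7) (orderOf_dvd_of_pow_eq_one hq)

/-- A ring automorphism of a field of characteristic two, as an automorphism over `ZMod 2`. -/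
def ringAutToGal [Algebra (ZMod 2) F] (σ : F ≃+* F) : F ≃ₐ[ZMod 2] F :=
  AlgEquiv.ofRingEquiv (f := σ) fun r => by
    have : (σ : F →+* F).comp (algebraMap (ZMod 2) F) = algebraMap (ZMod 2) F :=
      Subsingleton.elim _ _
    exact congrArg (fun f => f r) this

lemma card_gal [Algebra (ZMod 2) F] {p : ℕ} (hF : Nat.card F = 2 ^ p) :
    Nat.card (F ≃ₐ[ZMod 2] F) = p := by
  have h1 := Module.natCard_eq_pow_finrank (K := ZMod 2) (V := F)
  rw [hF, Nat.card_zmod] at h1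
  rw [IsGalois.card_aut_eq_finrank]
  exact (Nat.pow_right_injective le_rfl h1).symm

/-- An automorphism of a field of prime degree over `GF(2)` with a fixed element outside `GF(2)`
is trivial: otherwise the Frobenius is one of its powers. -/
lemma eq_refl_of_fixed [Algebra (ZMod 2) F] {p : ℕ} (hp : p.Prime) (hF : Nat.card F = 2 ^ p)
    (σ : F ≃+* F) {r : F} (h0 : r ≠ 0) (h1 : r ≠ 1) (h : σ r = r) : σ = RingEquiv.refl F := by
  by_contra hσ
  have : Fact p.Prime := ⟨hp⟩
  have hne : ringAutToGal σ ≠ 1 := by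
    intro h2
    apply hσ
    ext x
    exact congrArg (fun f : F ≃ₐ[ZMod 2] F => f x) h2
  have hfix : ringAutToGal σ ∈ MulAction.stabilizer (F ≃ₐ[ZMod 2] F) r := h
  have hfrob : FiniteField.frobeniusAlgEquivOfAlgebraic (ZMod 2) F ∈
      MulAction.stabilizer (F ≃ₐ[ZMod 2] F) r :=
    (Subgroup.zpowers_le.2 hfix) (mem_zpowers_of_prime_card (card_gal hF) hne)
  have h2 : r ^ 2 = r := by
    have : FiniteField.frobeniusAlgEquivOfAlgebraic (ZMod 2) F r = r := hfrob
    simpa [FiniteField.coe_frobeniusAlgEquivOfAlgebraic] using this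
  apply h1
  apply mul_left_cancel₀ h0
  rw [← sq, h2, mul_one]

lemma exists_iterate_eq {F : Type*} [Field F] (σ : F ≃+* F) {k : F} (hk : k ≠ 0) (n : ℕ) :
    ∃ N : F, N ≠ 0 ∧ ∀ x, (fun x => k * σ x)^[n] x = N * σ^[n] x := by
  induction n with
  | zero => exact ⟨1, one_ne_zero, fun x => by simp⟩
  | succ n ih =>
    obtain ⟨N, hN, h⟩ := ih
    refine ⟨k * σ N, mul_ne_zero hk (by simpa using hN), fun x => ?_⟩
    rw [Function.iterate_succ_apply', Function.iterate_succ_apply', h, map_mul, mul_assoc]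

/-- A semilinear map `x ↦ k x ^ σ` preserving an additive subgroup `A` of order `8` is the identity.
Its `p`-th power is multiplication by a scalar and hence trivial on `A`. The fixed points on `A`
form a subgroup whose order is congruent to `8` modulo `p`, so they are all of `A`. -/
lemma eq_refl_and_eq_one_of_forall_mem [Algebra (ZMod 2) F] {p : ℕ} (hp : p.Prime) (hp2 : p ≠ 2)
    (hp3 : p ≠ 3) (hp7 : p ≠ 7) (hF : Nat.card F = 2 ^ p)
    (A : AddSubgroup F) (hA : Nat.card A = 8) (σ : F ≃+* F) {k : F} (hk : k ≠ 0)
    (h : ∀ x ∈ A, k * σ x ∈ A) : σ = RingEquiv.refl F ∧ k = 1 := by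
  classical
  have : Fact p.Prime := ⟨hp⟩
  have : Fintype A := Fintype.ofFinite A
  let f : Function.End A := fun x => ⟨k * σ x, h x x.2⟩
  have hval : ∀ n (x : A), ((f^[n] x : A) : F) = (fun x => k * σ x)^[n] x := by
    intro n
    induction n with
    | zero => intro x; rfl
    | succ n ih => intro x; rw [Function.iterate_succ_apply', Function.iterate_succ_apply', ← ih]
  obtain ⟨N, hN, hiter⟩ := exists_iterate_eq σ hk p
  have hσp : ∀ x, σ^[p] x = x := by
    intro x
    have h1 : ringAutToGal σ ^ p = 1 := by
      rw [← card_gal hF]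
      exact pow_card_eq_one'
    have h2 : (ringAutToGal σ ^ p) x = σ^[p] x := by
      rw [AlgEquiv.coe_pow]
      rfl
    rw [← h2, h1, AlgEquiv.one_apply]
  have hN1 : N = 1 := eq_one_of_forall_mul_mem hp hp3 hF A hA hN fun x hx => by
    have h1 := hval p ⟨x, hx⟩
    rw [hiter, hσp] at h1
    rw [← h1]
    exact Subtype.prop _
  have hfp : f ^ p ^ 1 = 1 := by
    have hpow : f ^ p = f^[p] := hom_coe_pow (fun g : Function.End A => g) rfl (fun _ _ => rfl) f p
    rw [pow_one, hpow]
    funext x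
    refine Subtype.ext ((hval p x).trans ?_)
    rw [hiter, hσp, hN1, one_mul]
    rfl
  let B : AddSubgroup A :=
    { carrier := {x | f x = x}
      zero_mem' := Subtype.ext (by simp [f])
      add_mem' := by
        intro x y hx hy
        have hx' := congrArg Subtype.val hx
        have hy' := congrArg Subtype.val hy
        simp only [f] at hx' hy'
        refine Subtype.ext ?_
        simp only [f, AddSubgroup.coe_add, map_add, mul_add, hx', hy']
      neg_mem' := by
        intro x hx
        have hx' := congrArg Subtype.val hx
        simp only [f] at hx'
        refine Subtype.ext ?_
        simp only [f, AddSubgroup.coe_neg, map_neg, mul_neg, hx'] }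
  have hmod : 8 ≡ Nat.card B [MOD p] := by
    have h1 := Equiv.Perm.card_fixedPoints_modEq hfp
    rw [← Nat.card_eq_fintype_card, hA, ← Nat.card_eq_fintype_card] at h1
    exact h1
  have hdvd : Nat.card B ∣ 8 := hA ▸ AddSubgroup.card_addSubgroup_dvd_card B
  have hB : Nat.card B = 8 := by
    have hmem : Nat.card B ∈ Nat.divisors 8 := Nat.mem_divisors.2 ⟨hdvd, by norm_num⟩
    rw [show Nat.divisors 8 = {1, 2, 4, 8} by decide] at hmem
    have hpd : p ∣ 8 - Nat.card B :=
      (Nat.modEq_iff_dvd' (Nat.le_of_dvd (by norm_num) hdvd)).1 hmod.symm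
    simp only [Finset.mem_insert, Finset.mem_singleton] at hmem
    rcases hmem with h1 | h1 | h1 | h1 <;> rw [h1] at hpd
    · exact absurd ((Nat.prime_dvd_prime_iff_eq hp (by norm_num)).1 hpd) hp7
    · rcases (Nat.Prime.dvd_mul hp).1 (show p ∣ 2 * 3 from hpd) with h2 | h2
      · exact absurd ((Nat.prime_dvd_prime_iff_eq hp Nat.prime_two).1 h2) hp2
      · exact absurd ((Nat.prime_dvd_prime_iff_eq hp Nat.prime_three).1 h2) hp3
    · have h2 : p ∣ 2 := hp.dvd_of_dvd_pow (show p ∣ 2 ^ 2 from hpd)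
      exact absurd ((Nat.prime_dvd_prime_iff_eq hp Nat.prime_two).1 h2) hp2
    · exact h1
  have hBtop : B = ⊤ := AddSubgroup.eq_top_of_card_eq B (hB.trans hA.symm)
  have hfix : ∀ x ∈ A, k * σ x = x := fun x hx =>
    congrArg Subtype.val (show (⟨x, hx⟩ : A) ∈ B by rw [hBtop]; trivial)
  -- two distinct non-zero elements of `A` have a quotient fixed by `σ` and outside `GF(2)`
  obtain ⟨x, y, hx, hy, hx0, hy0, hxy⟩ :
      ∃ x y : F, x ∈ A ∧ y ∈ A ∧ x ≠ 0 ∧ y ≠ 0 ∧ x ≠ y := by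
    have h3 : 2 < Fintype.card A := by rw [← Nat.card_eq_fintype_card, hA]; norm_num
    obtain ⟨a, b, c, hab, hac, hbc⟩ := Fintype.two_lt_card_iff.1 h3
    by_cases ha : a = 0
    · exact ⟨b, c, b.2, c.2, by simpa [ha] using hab.symm, by simpa [ha] using hac.symm,
        by simpa using hbc⟩
    · by_cases hb : b = 0
      · exact ⟨a, c, a.2, c.2, by simpa using ha, by simpa [hb] using hbc.symm,
          by simpa using hac⟩
      · exact ⟨a, b, a.2, b.2, by simpa using ha, by simpa using hb, by simpa using hab⟩
  have hσ : σ = RingEquiv.refl F := by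
    apply eq_refl_of_fixed hp hF σ (r := x / y) (div_ne_zero hx0 hy0)
    · rwa [Ne, div_eq_one_iff_eq hy0]
    · rw [map_div₀, ← mul_div_mul_left _ _ hk, hfix x hx, hfix y hy]
  refine ⟨hσ, ?_⟩
  have h1 := hfix x hx
  rw [hσ, RingEquiv.refl_apply] at h1
  exact mul_right_cancel₀ hx0 (h1.trans (one_mul _).symm)

end Semilinear

/-! ### Collineations mapping a conic into the union of seven conics -/

/-- The quadratic form `α x² + x y + β y² + lam z²` of the parameters `c`. -/
def ConicParam.form {F : Type*} [Field F] (c : ConicParam F) (v : Fin 3 → F) : F :=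
  c.α * v 0 ^ 2 + v 0 * v 1 + c.β * v 1 ^ 2 + c.lam * v 2 ^ 2

/-- The field automorphism `σ` applied to the parameters of a curve. -/
def ConicParam.map {F : Type*} [Field F] (σ : F ≃+* F) (c : ConicParam F) : ConicParam F :=
  ⟨σ c.α, σ c.β, σ c.lam⟩

section Field

variable {F : Type*} [Field F]

lemma ConicParam.form_smul (c : ConicParam F) (a : F) (v : Fin 3 → F) :
    c.form (a • v) = a ^ 2 * c.form v := by
  simp only [form, Pi.smul_apply, smul_eq_mul]
  ring

lemma ConicParam.form_map (σ : F ≃+* F) (c : ConicParam F) (v : Fin 3 → F) :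
    (c.map σ).form (fun i => σ (v i)) = σ (c.form v) := by
  simp [form, map]

lemma ConicParam.mk_mem_points (c : ConicParam F) {v : Fin 3 → F} (hv : v ≠ 0) :
    Projectivization.mk F v hv ∈ c.points ↔ c.form v = 0 := by
  constructor
  · rintro ⟨w, hw, h, h0⟩
    obtain ⟨a, ha⟩ := (Projectivization.mk_eq_mk_iff' F v w hv hw).1 h
    have h0 : c.form w = 0 := h0
    rw [← ha, form_smul, h0, mul_zero]
  · intro h
    exact ⟨v, hv, rfl, h⟩

lemma mk_eq_nucleus {v : Fin 3 → F} (hv : v ≠ 0) :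
    Projectivization.mk F v hv = nucleus F ↔ v 0 = 0 ∧ v 1 = 0 := by
  rw [nucleus, Projectivization.mk_eq_mk_iff']
  constructor
  · rintro ⟨a, rfl⟩
    simp
  · rintro ⟨h0, h1⟩
    refine ⟨v 2, ?_⟩
    ext i
    fin_cases i <;> simp [h0, h1]

lemma mk_mem_arcOf (C : Set (ConicParam F)) {v : Fin 3 → F} (hv : v ≠ 0) :
    Projectivization.mk F v hv ∈ arcOf C ↔ (v 0 = 0 ∧ v 1 = 0) ∨ ∃ c ∈ C, c.form v = 0 := by
  simp only [arcOf, Set.mem_union, Set.mem_singleton_iff, mk_eq_nucleus, Set.mem_iUnion,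
    ConicParam.mk_mem_points, exists_prop]

variable [CharP F 2]

lemma two_eq_zero : (2 : F) = 0 := CharTwo.two_eq_zero

lemma exists_sq_eq [Finite F] (a : F) : ∃ b : F, b ^ 2 = a := by
  obtain ⟨b, hb⟩ := FiniteField.isSquare_of_char_two (ringChar.eq F 2) a
  exact ⟨b, by rw [hb, sq]⟩

/-- The curve `d` is parametrised by the points `(1, t², L (a + t + b t²))` with `a² = α`,
`b² = β`, `L² lam = 1`. If the quartic polynomial obtained by substituting them into `c.form ∘ M`
vanishes, then `c.form ∘ M` is a scalar multiple of `d.form`, and `M` fixes `(0, 0, 1)` because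
that point spans the radical of the polar form of every `ConicParam.form`. -/
lemma coeff_relations (c d : ConicParam F) (M : Matrix (Fin 3) (Fin 3) F) (hM : M.det ≠ 0)
    {a b L : F} (ha : a ^ 2 = d.α) (hb : b ^ 2 = d.β) (hL : L ^ 2 * d.lam = 1)
    {f : Polynomial F}
    (hf : f = Polynomial.C c.α * (.C (M 0 0) + .C (M 0 1) * .X ^ 2
            + .C (M 0 2 * L) * (.C a + .X + .C b * .X ^ 2)) ^ 2
          + (.C (M 0 0) + .C (M 0 1) * .X ^ 2 + .C (M 0 2 * L) * (.C a + .X + .C b * .X ^ 2))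
            * (.C (M 1 0) + .C (M 1 1) * .X ^ 2 + .C (M 1 2 * L) * (.C a + .X + .C b * .X ^ 2))
          + .C c.β * (.C (M 1 0) + .C (M 1 1) * .X ^ 2
            + .C (M 1 2 * L) * (.C a + .X + .C b * .X ^ 2)) ^ 2
          + .C c.lam * (.C (M 2 0) + .C (M 2 1) * .X ^ 2
            + .C (M 2 2 * L) * (.C a + .X + .C b * .X ^ 2)) ^ 2)
    (h0 : f = 0) :
    M 0 2 = 0 ∧ M 1 2 = 0 ∧ M 2 2 ≠ 0 ∧ M 0 0 * M 1 1 + M 0 1 * M 1 0 ≠ 0 ∧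
    c.lam * M 2 2 ^ 2 = (M 0 0 * M 1 1 + M 0 1 * M 1 0) * d.lam ∧
    c.α * M 0 0 ^ 2 + M 0 0 * M 1 0 + c.β * M 1 0 ^ 2 + c.lam * M 2 0 ^ 2
      = (M 0 0 * M 1 1 + M 0 1 * M 1 0) * d.α ∧
    c.α * M 0 1 ^ 2 + M 0 1 * M 1 1 + c.β * M 1 1 ^ 2 + c.lam * M 2 1 ^ 2
      = (M 0 0 * M 1 1 + M 0 1 * M 1 0) * d.β := by
  have h2 : (2 : F) = 0 := two_eq_zero
  have hL0 : L ≠ 0 := by rintro rfl; simp at hL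
  -- the coefficients of the quadratic form `c.form ∘ M`
  set A' := c.α * M 0 0 ^ 2 + M 0 0 * M 1 0 + c.β * M 1 0 ^ 2 + c.lam * M 2 0 ^ 2 with hA'
  set B' := c.α * M 0 1 ^ 2 + M 0 1 * M 1 1 + c.β * M 1 1 ^ 2 + c.lam * M 2 1 ^ 2 with hB'
  set C' := c.α * M 0 2 ^ 2 + M 0 2 * M 1 2 + c.β * M 1 2 ^ 2 + c.lam * M 2 2 ^ 2 with hC'
  set D' := M 0 0 * M 1 1 + M 0 1 * M 1 0 with hD'
  set E' := M 0 0 * M 1 2 + M 0 2 * M 1 0 with hE'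
  set F' := M 0 1 * M 1 2 + M 0 2 * M 1 1 with hF'
  have hcoef : f = .C (A' + C' * L ^ 2 * a ^ 2 + E' * L * a) + .C (E' * L) * .X
      + .C (D' + C' * L ^ 2 + E' * L * b + F' * L * a) * .X ^ 2
      + .C (F' * L) * .X ^ 3 + .C (B' + C' * L ^ 2 * b ^ 2 + F' * L * b) * .X ^ 4 := by
    have h2X : (2 : Polynomial F) = 0 := CharTwo.two_eq_zero
    rw [hf, hA', hB', hC', hD', hE', hF']
    simp only [map_add, map_mul, map_pow]
    grind
  have k0 := congrArg (fun q => Polynomial.coeff q 0) (hcoef.symm.trans h0)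
  have k1 := congrArg (fun q => Polynomial.coeff q 1) (hcoef.symm.trans h0)
  have k2 := congrArg (fun q => Polynomial.coeff q 2) (hcoef.symm.trans h0)
  have k3 := congrArg (fun q => Polynomial.coeff q 3) (hcoef.symm.trans h0)
  have k4 := congrArg (fun q => Polynomial.coeff q 4) (hcoef.symm.trans h0)
  simp only [Polynomial.coeff_add, Polynomial.coeff_C_mul, Polynomial.coeff_X_pow,
    Polynomial.coeff_X, Polynomial.coeff_C, Polynomial.coeff_zero] at k0 k1 k2 k3 k4
  norm_num at k0 k1 k2 k3 k4
  have hE0 : E' = 0 := k1.resolve_right hL0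
  have hF0 : F' = 0 := k3.resolve_right hL0
  rw [hE0] at k0 k2
  rw [hF0] at k2 k4
  have hdet : M.det = M 2 2 * D' := by
    rw [Matrix.det_fin_three]
    linear_combination (M 2 1) * hE0 + (M 2 0) * hF0
      - (M 2 2 * M 0 1 * M 1 0 + M 2 1 * M 0 0 * M 1 2 + M 2 0 * M 0 2 * M 1 1) * h2
  rw [hdet] at hM
  have hM22 := left_ne_zero_of_mul hM
  have hD0 := right_ne_zero_of_mul hM
  have h02 : M 0 2 = 0 := by
    apply (mul_eq_zero.1 (_ : M 0 2 * D' = 0)).resolve_right hD0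
    linear_combination M 0 0 * hF0 + M 0 1 * hE0 - M 0 0 * M 0 1 * M 1 2 * h2
  have h12 : M 1 2 = 0 := by
    apply (mul_eq_zero.1 (_ : M 1 2 * D' = 0)).resolve_right hD0
    linear_combination M 1 0 * hF0 + M 1 1 * hE0 - M 1 0 * M 1 1 * M 0 2 * h2
  have hCl : C' = c.lam * M 2 2 ^ 2 := by rw [hC', h02, h12]; ring
  have hCL : C' * L ^ 2 = D' := by linear_combination k2 - D' * h2
  refine ⟨h02, h12, hM22, hD0, ?_, ?_, ?_⟩
  · rw [← hCl]
    linear_combination d.lam * hCL - C' * hL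
  · linear_combination k0 - a ^ 2 * hCL + D' * ha - D' * a ^ 2 * h2
  · linear_combination k4 - b ^ 2 * hCL + D' * hb - D' * b ^ 2 * h2

/-- If an invertible matrix maps a curve `d` into the arc of a set `C` of seven curves over a field
with at least `32` elements, it maps `d` to a member of `C`: along the parametrisation of `d`, a
product of eight polynomials of total degree at most `2 + 7 * 4 = 30` has every field element as a
root. -/
lemma exists_image_conic [Finite F] (hF : 32 ≤ Nat.card F) {C : Set (ConicParam F)}
    (hC : C.ncard = 7) {d : ConicParam F} (hd : d.lam ≠ 0) (M : Matrix (Fin 3) (Fin 3) F)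
    (hM : M.det ≠ 0)
    (h : ∀ v : Fin 3 → F, v ≠ 0 → d.form v = 0 →
      ((M.mulVec v) 0 = 0 ∧ (M.mulVec v) 1 = 0) ∨ ∃ c ∈ C, c.form (M.mulVec v) = 0) :
    M 0 2 = 0 ∧ M 1 2 = 0 ∧ M 2 2 ≠ 0 ∧ M 0 0 * M 1 1 + M 0 1 * M 1 0 ≠ 0 ∧ ∃ c ∈ C,
    c.lam * M 2 2 ^ 2 = (M 0 0 * M 1 1 + M 0 1 * M 1 0) * d.lam ∧
    c.α * M 0 0 ^ 2 + M 0 0 * M 1 0 + c.β * M 1 0 ^ 2 + c.lam * M 2 0 ^ 2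
      = (M 0 0 * M 1 1 + M 0 1 * M 1 0) * d.α ∧
    c.α * M 0 1 ^ 2 + M 0 1 * M 1 1 + c.β * M 1 1 ^ 2 + c.lam * M 2 1 ^ 2
      = (M 0 0 * M 1 1 + M 0 1 * M 1 0) * d.β := by
  classical
  have := Fintype.ofFinite F
  have h2 : (2 : F) = 0 := two_eq_zero
  obtain ⟨a, ha⟩ := exists_sq_eq d.α
  obtain ⟨b, hb⟩ := exists_sq_eq d.β
  obtain ⟨L, hL⟩ := exists_sq_eq d.lam⁻¹
  have hL1 : L ^ 2 * d.lam = 1 := by rw [hL, inv_mul_cancel₀ hd]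
  have hL0 : L ≠ 0 := by rintro rfl; simp at hL1
  have hCfin : C.Finite := Set.finite_of_ncard_ne_zero (by omega)
  let P : Fin 3 → Polynomial F := fun i => .C (M i 0) + .C (M i 1) * .X ^ 2
    + .C (M i 2 * L) * (.C a + .X + .C b * .X ^ 2)
  let f : ConicParam F → Polynomial F := fun c =>
    .C c.α * P 0 ^ 2 + P 0 * P 1 + .C c.β * P 1 ^ 2 + .C c.lam * P 2 ^ 2
  have hPdeg : ∀ i, (P i).natDegree ≤ 2 := by
    intro i
    simp only [P]
    compute_degree
  have hfdeg : ∀ c, (f c).natDegree ≤ 4 := by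
    intro c
    have h0 := hPdeg 0
    have h1 := hPdeg 1
    have h3 := hPdeg 2
    simp only [f]
    refine Polynomial.natDegree_add_le_of_degree_le (Polynomial.natDegree_add_le_of_degree_le
      (Polynomial.natDegree_add_le_of_degree_le ?_ ?_) ?_) ?_
    · exact (Polynomial.natDegree_C_mul_le _ _).trans
        (Polynomial.natDegree_pow_le_of_le 2 h0)
    · exact Polynomial.natDegree_mul_le_of_le h0 h1
    · exact (Polynomial.natDegree_C_mul_le _ _).trans
        (Polynomial.natDegree_pow_le_of_le 2 h1)
    · exact (Polynomial.natDegree_C_mul_le _ _).trans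
        (Polynomial.natDegree_pow_le_of_le 2 h3)
  let g : Polynomial F := P 0 * ∏ c ∈ hCfin.toFinset, f c
  have hgdeg : g.natDegree ≤ 30 := by
    have h1 : (∏ c ∈ hCfin.toFinset, f c).natDegree ≤ 28 := by
      refine (Polynomial.natDegree_prod_le _ _).trans
        ((Finset.sum_le_card_nsmul _ _ 4 fun c _ => hfdeg c).trans ?_)
      rw [← Set.ncard_eq_toFinset_card C hCfin, hC, smul_eq_mul]
    exact Polynomial.natDegree_mul_le_of_le (hPdeg 0) h1
  have hgroot : ∀ t : F, g.eval t = 0 := by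
    intro t
    let v : Fin 3 → F := ![1, t ^ 2, L * (a + t + b * t ^ 2)]
    have hv : v ≠ 0 := fun hv => one_ne_zero (congrFun hv 0)
    have hform : d.form v = 0 := by
      simp only [ConicParam.form, v, Matrix.cons_val_zero, Matrix.cons_val_one, Matrix.cons_val]
      rw [← ha, ← hb]
      linear_combination (a + t + b * t ^ 2) ^ 2 * hL1
        + (a ^ 2 + t ^ 2 + b ^ 2 * t ^ 4 + a * t + a * b * t ^ 2 + b * t ^ 3) * h2
    have hP : ∀ i, (P i).eval t = (M.mulVec v) i := by
      intro i
      simp only [P, Polynomial.eval_add, Polynomial.eval_mul, Polynomial.eval_C,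
        Polynomial.eval_pow, Polynomial.eval_X, Matrix.mulVec, dotProduct, Fin.sum_univ_three, v,
        Matrix.cons_val_zero, Matrix.cons_val_one, Matrix.cons_val]
      ring
    have hf : ∀ c, (f c).eval t = c.form (M.mulVec v) := by
      intro c
      simp only [f, Polynomial.eval_add, Polynomial.eval_mul, Polynomial.eval_C,
        Polynomial.eval_pow, hP, ConicParam.form]
    simp only [g, Polynomial.eval_mul, Polynomial.eval_prod]
    rcases h v hv hform with ⟨h0, _⟩ | ⟨c, hc, h0⟩
    · rw [hP, h0, zero_mul]
    · rw [Finset.prod_eq_zero (hCfin.mem_toFinset.2 hc) ((hf c).trans h0), mul_zero]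
  have hg0 : g = 0 := by
    apply Polynomial.eq_zero_of_natDegree_lt_card_of_eval_eq_zero g
      (Function.injective_id (α := F)) hgroot
    rw [← Nat.card_eq_fintype_card]
    omega
  rcases mul_eq_zero.1 hg0 with hP0 | hprod
  · -- the first row of `M` would be zero
    exfalso
    have k0 := congrArg (fun q => Polynomial.coeff q 0) hP0
    have k1 := congrArg (fun q => Polynomial.coeff q 1) hP0
    have k2 := congrArg (fun q => Polynomial.coeff q 2) hP0
    simp only [P, Polynomial.coeff_add, Polynomial.coeff_C_mul, Polynomial.coeff_X_pow,
      Polynomial.coeff_X, Polynomial.coeff_C, Polynomial.coeff_zero] at k0 k1 k2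
    norm_num at k0 k1 k2
    have h02 : M 0 2 = 0 := k1.resolve_right hL0
    rw [h02] at k0 k2
    simp only [zero_mul, add_zero] at k0 k2
    apply hM
    rw [Matrix.det_fin_three, k0, k2, h02]
    ring
  · obtain ⟨c, hc, hc0⟩ := Finset.prod_eq_zero_iff.1 hprod
    obtain ⟨r1, r2, r3, r4, r5⟩ := coeff_relations c d M hM ha hb hL1 rfl hc0
    exact ⟨r1, r2, r3, r4, c, hCfin.mem_toFinset.1 hc, r5⟩

end Field

/-! ### Closed sets of conics and their affine relations -/

lemma exists_two_members {F : Type*} {C : Set (ConicParam F)} (h7 : C.ncard = 7) :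
    ∃ c ∈ C, ∃ d ∈ C, c ≠ d := by
  have hfin : C.Finite := Set.finite_of_ncard_ne_zero (by omega)
  obtain ⟨c, d, hc, hd, h⟩ := (Set.one_lt_ncard_iff hfin).1 (by omega)
  exact ⟨c, hc, d, hd, h⟩

lemma relation_comp {F : Type*} [Field F] [CharP F 2] {c d : ConicParam F}
    (h : c.lam + d.lam ≠ 0) {u v w k : F}
    (hc : u * c.α + v + w * c.β = k * c.lam) (hd : u * d.α + v + w * d.β = k * d.lam) :
    u * (c.comp d).α + v + w * (c.comp d).β = k * (c.comp d).lam := by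
  have h2 : (2 : F) = 0 := two_eq_zero
  simp only [ConicParam.comp]
  field_simp
  linear_combination c.lam * hc + d.lam * hd - k * c.lam * d.lam * h2

section Closed

variable {F : Type*} [Field F] [Algebra (ZMod 2) F]

lemma trace_sq [Finite F] (x : F) :
    Algebra.trace (ZMod 2) F (x ^ 2) = Algebra.trace (ZMod 2) F x := by
  have h := Algebra.trace_eq_of_algEquiv (FiniteField.frobeniusAlgEquivOfAlgebraic (ZMod 2) F) x
  simpa [FiniteField.coe_frobeniusAlgEquivOfAlgebraic] using h

/-- The relation `u α + v + w β = k lam` holds for all members of `C`. After multiplication by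
`lam` this is a linear dependence between the additive functions `lam ↦ α lam`, `lam ↦ lam`,
`lam ↦ β lam` and `lam ↦ lam ^ 2`. -/
def HasRelation (C : Set (ConicParam F)) (u v w k : F) : Prop :=
  ∀ c ∈ C, u * c.α + v + w * c.β = k * c.lam

lemma eq_zero_of_relation {C : Set (ConicParam F)} (hC : IsClosedConicSet C)
    (h7 : C.ncard = 7) {v k : F} (h : HasRelation C 0 v 0 k) : v = 0 ∧ k = 0 := by
  obtain ⟨c, hc, d, hd, hne⟩ := exists_two_members h7
  have e1 := h c hc
  have e2 := h d hd
  have hk : k = 0 := by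
    apply (mul_eq_zero.1 (_ : k * (c.lam - d.lam) = 0)).resolve_right
      (sub_ne_zero.2 (hC.lam_ne c hc d hd hne))
    linear_combination e2 - e1
  refine ⟨?_, hk⟩
  rw [hk] at e1
  linear_combination e1

variable [CharP F 2]

/-- The additive subgroup consisting of `0` and the parameters `lam` of a closed set. -/
def lamSubgroup {C : Set (ConicParam F)} (hC : IsClosedConicSet C) : AddSubgroup F where
  carrier := insert 0 (ConicParam.lam '' C)
  zero_mem' := Set.mem_insert _ _
  add_mem' := by
    rintro x y (rfl | ⟨c, hc, rfl⟩) (rfl | ⟨d, hd, rfl⟩)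
    · simp
    · rw [zero_add]; exact Or.inr ⟨d, hd, rfl⟩
    · rw [add_zero]; exact Or.inr ⟨c, hc, rfl⟩
    · by_cases h : c = d
      · rw [h, CharTwo.add_self_eq_zero]; exact Or.inl rfl
      · exact Or.inr ⟨c.comp d, hC.comp_mem c hc d hd h, rfl⟩
  neg_mem' := by
    intro x hx
    rwa [CharTwo.neg_eq]

lemma card_lamSubgroup [Finite F] {C : Set (ConicParam F)} (hC : IsClosedConicSet C)
    (hfin : C.Finite) : Nat.card (lamSubgroup hC) = C.ncard + 1 := by
  have h1 : Nat.card (lamSubgroup hC) = (insert 0 (ConicParam.lam '' C)).ncard := rfl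
  rw [h1, Set.ncard_insert_of_notMem _ (hfin.image _), Set.InjOn.ncard_image]
  · intro c hc d hd h
    by_contra hne
    exact hC.lam_ne c hc d hd hne h
  · rintro ⟨c, hc, h⟩
    exact hC.lam_ne_zero c hc h

lemma add_lam_ne_zero {C : Set (ConicParam F)} (hC : IsClosedConicSet C) {c d : ConicParam F}
    (hc : c ∈ C) (hd : d ∈ C) (h : c ≠ d) : c.lam + d.lam ≠ 0 :=
  fun h0 => hC.lam_ne c hc d hd h (CharTwo.add_eq_zero.1 h0)

/-- A closed set of seven conics is generated by three of them, so that a relation holding for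
these holds throughout. -/
lemma exists_generators [Finite F] {C : Set (ConicParam F)} (hC : IsClosedConicSet C)
    (h7 : C.ncard = 7) : ∃ c₁ c₂ c₃ : ConicParam F, ∀ u v w k : F,
      u * c₁.α + v + w * c₁.β = k * c₁.lam → u * c₂.α + v + w * c₂.β = k * c₂.lam →
      u * c₃.α + v + w * c₃.β = k * c₃.lam → HasRelation C u v w k := by
  have hfin : C.Finite := Set.finite_of_ncard_ne_zero (by omega)
  obtain ⟨c₁, h1⟩ : C.Nonempty := Set.nonempty_of_ncard_ne_zero (by omega)
  obtain ⟨c₂, h2, h12⟩ : ∃ c ∈ C, c ∉ ({c₁} : Set (ConicParam F)) :=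
    Set.exists_mem_notMem_of_ncard_lt_ncard (by rw [Set.ncard_singleton, h7]; norm_num)
  have hne : c₁ ≠ c₂ := fun h => h12 h.symm
  obtain ⟨c₃, h3, h123⟩ : ∃ c ∈ C, c ∉ ({c₁, c₂, c₁.comp c₂} : Set (ConicParam F)) := by
    refine Set.exists_mem_notMem_of_ncard_lt_ncard ?_
    rw [h7]
    exact (Set.ncard_insert_le _ _).trans_lt (Nat.lt_of_le_of_lt
      (Nat.succ_le_succ ((Set.ncard_insert_le _ _).trans
        (Nat.succ_le_succ (Set.ncard_singleton _).le))) (by norm_num))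
  simp only [Set.mem_insert_iff, Set.mem_singleton_iff, not_or] at h123
  obtain ⟨h31, h32, h312⟩ := h123
  refine ⟨c₁, c₂, c₃, fun u v w k r1 r2 r3 => ?_⟩
  -- the members satisfying the relation form a closed set `D`
  let D : Set (ConicParam F) := {c ∈ C | u * c.α + v + w * c.β = k * c.lam}
  have hDC : D ⊆ C := fun c hc => hc.1
  have hD : IsClosedConicSet D :=
    { trace_eq_one := fun c hc => hC.trace_eq_one c hc.1
      lam_ne_zero := fun c hc => hC.lam_ne_zero c hc.1
      lam_ne := fun c hc d hd => hC.lam_ne c hc.1 d hd.1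
      comp_mem := fun c hc d hd h => ⟨hC.comp_mem c hc.1 d hd.1 h,
        relation_comp (add_lam_ne_zero hC hc.1 hd.1 h) hc.2 hd.2⟩ }
  have hDfin : D.Finite := hfin.subset hDC
  have m1 : c₁ ∈ D := ⟨h1, r1⟩
  have m2 : c₂ ∈ D := ⟨h2, r2⟩
  have m3 : c₃ ∈ D := ⟨h3, r3⟩
  have m12 : c₁.comp c₂ ∈ D := hD.comp_mem _ m1 _ m2 hne
  have hle : lamSubgroup hD ≤ lamSubgroup hC := by
    rintro x (rfl | ⟨c, hc, rfl⟩)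
    · exact zero_mem _
    · exact Or.inr ⟨c, hc.1, rfl⟩
  have hdvd : D.ncard + 1 ∣ 8 := by
    have h := AddSubgroup.card_dvd_of_le hle
    rwa [card_lamSubgroup hD hDfin, card_lamSubgroup hC hfin, h7] at h
  have h4 : 4 ≤ D.ncard := by
    have hne1 : c₁ ≠ c₁.comp c₂ := by
      intro h
      have h' : c₁.lam = c₁.lam + c₂.lam := congrArg ConicParam.lam h
      exact hC.lam_ne_zero c₂ h2 (left_eq_add.1 h')
    have hne2 : c₂ ≠ c₁.comp c₂ := by
      intro h
      have h' : c₂.lam = c₁.lam + c₂.lam := congrArg ConicParam.lam h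
      exact hC.lam_ne_zero c₁ h1 (right_eq_add.1 h')
    have h5 : ({c₃, c₁, c₂, c₁.comp c₂} : Set (ConicParam F)).ncard = 4 := by
      rw [Set.ncard_insert_of_notMem (by simp [h31, h32, h312]),
        Set.ncard_insert_of_notMem (by simp [hne, hne1]), Set.ncard_pair hne2]
    rw [← h5]
    refine Set.ncard_le_ncard ?_ hDfin
    rintro c (rfl | rfl | rfl | rfl) <;> assumption
  have hD7 : D.ncard = 7 := by
    have hmem : D.ncard + 1 ∈ Nat.divisors 8 := Nat.mem_divisors.2 ⟨hdvd, by norm_num⟩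
    rw [show Nat.divisors 8 = {1, 2, 4, 8} by decide] at hmem
    simp only [Finset.mem_insert, Finset.mem_singleton] at hmem
    omega
  have hDeq : D = C := Set.eq_of_subset_of_ncard_le hDC (by rw [h7, hD7]) hfin
  intro c hc
  exact (hDeq ▸ hc : c ∈ D).2

/-- Four unknowns against the three equations given by generators. -/
lemma exists_relation [Finite F] {C : Set (ConicParam F)} (hC : IsClosedConicSet C)
    (h7 : C.ncard = 7) : ∃ u v w k : F, ¬ (u = 0 ∧ v = 0 ∧ w = 0 ∧ k = 0) ∧
      HasRelation C u v w k := by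
  obtain ⟨c₁, c₂, c₃, h⟩ := exists_generators hC h7
  let N : Matrix (Fin 3) (Fin 4) F :=
    !![c₁.α, 1, c₁.β, -c₁.lam; c₂.α, 1, c₂.β, -c₂.lam; c₃.α, 1, c₃.β, -c₃.lam]
  have hker : LinearMap.ker N.mulVecLin ≠ ⊥ := LinearMap.ker_ne_bot_of_finrank_lt (by simp)
  obtain ⟨x, hx, hx0⟩ := Submodule.exists_mem_ne_zero_of_ne_bot hker
  have hx' : N.mulVec x = 0 := hx
  have e1 := congrFun hx' 0
  have e2 := congrFun hx' 1
  have e3 := congrFun hx' 2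
  simp [N, Matrix.mulVec, dotProduct, Fin.sum_univ_four] at e1 e2 e3
  refine ⟨x 0, x 1, x 2, x 3, ?_, h _ _ _ _ ?_ ?_ ?_⟩
  · rintro ⟨h0, h1, h2, h3⟩
    apply hx0
    ext i
    fin_cases i <;> assumption
  · linear_combination e1
  · linear_combination e2
  · linear_combination e3

/-- On a relation with `v ^ 2 = u w`, where `w ≠ 0`, the trace condition turns into
`Tr ((k / w) lam α) = 1`, which is incompatible with the additivity of `lam α`. Geometrically, the
point `(√u, √w, √k)` would lie on all conics of the closed set, while these are disjoint. -/
lemma sq_ne_mul_of_relation_aux [Finite F] {C : Set (ConicParam F)}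
    (f g : ConicParam F → F)
    (htr : ∀ c ∈ C, Algebra.trace (ZMod 2) F (f c * g c) = 1)
    {c d e : ConicParam F} (hc : c ∈ C) (hd : d ∈ C) (he : e ∈ C)
    (hadd : f e * e.lam = f c * c.lam + f d * d.lam) {u v w k : F}
    (h : ∀ c ∈ C, u * f c + v + w * g c = k * c.lam) (hw : w ≠ 0) : v ^ 2 ≠ u * w := by
  intro huw
  have h2 : (2 : F) = 0 := two_eq_zero
  have key : ∀ c ∈ C, Algebra.trace (ZMod 2) F (k / w * (f c * c.lam)) = 1 := by
    intro c hc
    have h1 : f c * g c = k / w * (f c * c.lam) + v * f c / w + (v * f c / w) ^ 2 := by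
      field_simp
      linear_combination f c * w * h c hc + (f c) ^ 2 * huw - (f c * w * v + f c ^ 2 * v ^ 2) * h2
    have h3 := htr c hc
    rwa [h1, map_add, map_add, trace_sq, add_assoc, CharTwo.add_self_eq_zero, add_zero] at h3
  have h3 := key e he
  rw [hadd, mul_add, map_add, key c hc, key d hd] at h3
  exact absurd h3 (by decide)

lemma sq_ne_mul_of_relation [Finite F] {C : Set (ConicParam F)} (hC : IsClosedConicSet C)
    (h7 : C.ncard = 7) {u v w k : F} (h : HasRelation C u v w k)
    (hne : ¬ (u = 0 ∧ v = 0 ∧ w = 0 ∧ k = 0)) : v ^ 2 ≠ u * w := by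
  obtain ⟨c, hc, d, hd, hcd⟩ := exists_two_members h7
  have h0 := add_lam_ne_zero hC hc hd hcd
  by_cases hw : w = 0
  · by_cases hu : u = 0
    · rw [hu, hw] at h
      obtain ⟨hv, hk⟩ := eq_zero_of_relation hC h7 h
      exact absurd ⟨hu, hv, hw, hk⟩ hne
    · rw [mul_comm]
      refine sq_ne_mul_of_relation_aux (k := k) ConicParam.β ConicParam.α
        (fun c hc => by rw [mul_comm]; exact hC.trace_eq_one c hc) hc hd
        (hC.comp_mem c hc d hd hcd) (div_mul_cancel₀ _ h0) (fun c hc => ?_) hu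
      linear_combination h c hc
  · exact sq_ne_mul_of_relation_aux ConicParam.α ConicParam.β hC.trace_eq_one hc hd
      (hC.comp_mem c hc d hd hcd) (div_mul_cancel₀ _ h0) h hw

/-- A relation scaled so as to be the condition that the transvection `v ↦ v + B(v, w) w`, combined
with a suitable change of the third coordinate, preserves every conic of the closed set. -/
lemma exists_normalized_relation [Finite F] {C : Set (ConicParam F)} (hC : IsClosedConicSet C)
    (h7 : C.ncard = 7) : ∃ w₁ w₂ e : F, ¬ (w₁ = 0 ∧ w₂ = 0) ∧
      HasRelation C (w₁ ^ 2) (1 + w₁ * w₂) (w₂ ^ 2) (e ^ 2) := by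
  have h2 : (2 : F) = 0 := two_eq_zero
  obtain ⟨u, v, w, k, hne, h⟩ := exists_relation hC h7
  have hsq := sq_ne_mul_of_relation hC h7 h hne
  obtain ⟨u₀, rfl⟩ := exists_sq_eq u
  obtain ⟨w₀, rfl⟩ := exists_sq_eq w
  obtain ⟨k₀, rfl⟩ := exists_sq_eq k
  have hs : v + u₀ * w₀ ≠ 0 := by
    intro h0
    apply hsq
    linear_combination (v - u₀ * w₀) * h0
  obtain ⟨t, ht⟩ := exists_sq_eq (v + u₀ * w₀)⁻¹
  have ht1 : t ^ 2 * (v + u₀ * w₀) = 1 := by rw [ht, inv_mul_cancel₀ hs]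
  have hrel : HasRelation C ((t * u₀) ^ 2) (1 + t * u₀ * (t * w₀)) ((t * w₀) ^ 2)
      ((t * k₀) ^ 2) := by
    intro c hc
    linear_combination t ^ 2 * h c hc - ht1 + t ^ 2 * u₀ * w₀ * h2
  refine ⟨t * u₀, t * w₀, t * k₀, ?_, hrel⟩
  rintro ⟨e1, e2⟩
  rw [e1, e2] at hrel
  have := (eq_zero_of_relation hC h7 (by simpa using hrel)).1
  exact one_ne_zero this

end Closed

/-! ### Collineations given by matrices -/

section Matrices

variable {F : Type*} [Field F]

lemma exists_isInducedBy (M : Matrix (Fin 3) (Fin 3) F) (hM : M.det ≠ 0) :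
    ∃ g : Equiv.Perm (Point F), ∃ N : GL (Fin 3) F, N.1 = M ∧
      IsInducedBy g N (RingEquiv.refl F) := by
  let N : GL (Fin 3) F := Matrix.GeneralLinearGroup.mkOfDetNeZero M hM
  refine ⟨MulAction.toPerm (Matrix.GeneralLinearGroup.toLin N), N, rfl, fun v hv => ?_⟩
  have h : Matrix.GeneralLinearGroup.toLin N • v = N.1.mulVec v := rfl
  refine ⟨?_, ?_⟩
  · show N.1.mulVec v ≠ 0
    rw [← h]
    exact (smul_ne_zero_iff_ne _).2 hv
  · rw [MulAction.toPerm_apply, Projectivization.smul_mk]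
    rfl

lemma image_arcOf {C D : Set (ConicParam F)} {g : Equiv.Perm (Point F)} {M : GL (Fin 3) F}
    (hg : IsInducedBy g M (RingEquiv.refl F))
    (hM : ∀ v, (M.1.mulVec v 0 = 0 ∧ M.1.mulVec v 1 = 0) ↔ v 0 = 0 ∧ v 1 = 0)
    (h : ∀ v, (∃ c ∈ C, c.form (M.1.mulVec v) = 0) ↔ ∃ d ∈ D, d.form v = 0) :
    g '' arcOf D = arcOf C := by
  have key : ∀ P, g P ∈ arcOf C ↔ P ∈ arcOf D := by
    intro P
    induction P using Projectivization.ind with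
    | h v hv =>
      obtain ⟨hw, e⟩ := hg v hv
      rw [e, mk_mem_arcOf, mk_mem_arcOf]
      exact or_congr (hM v) (h v)
  ext Q
  constructor
  · rintro ⟨P, hP, rfl⟩
    exact (key P).2 hP
  · intro hQ
    exact ⟨g.symm Q, (key _).1 (by rwa [Equiv.apply_symm_apply]), Equiv.apply_symm_apply _ _⟩

lemma IsInducedBy.apply_of_eq_smul {g : Equiv.Perm (Point F)} {M : GL (Fin 3) F}
    (hg : IsInducedBy g M (RingEquiv.refl F)) {N : Matrix (Fin 3) (Fin 3) F} {μ : F}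
    (hM : M.1 = μ • N) {v : Fin 3 → F} (hv : v ≠ 0) (hNv : N.mulVec v ≠ 0) :
    g (Projectivization.mk F v hv) = Projectivization.mk F (N.mulVec v) hNv := by
  obtain ⟨hw, e⟩ := hg v hv
  rw [e, Projectivization.mk_eq_mk_iff']
  refine ⟨μ, ?_⟩
  rw [hM, Matrix.smul_mulVec]
  rfl

/-! ### The involution -/

/-- The matrix of the transvection `v ↦ v + B(v, w) w`, where `B` is the alternating form and
`w = (w₁, w₂)`, extended to three coordinates by `z ↦ z + e B(v, w)`. -/
def involutionMatrix (w₁ w₂ e : F) : Matrix (Fin 3) (Fin 3) F :=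
  !![1 + w₁ * w₂, w₁ ^ 2, 0; w₂ ^ 2, 1 + w₁ * w₂, 0; w₂ * e, w₁ * e, 1]

lemma mulVec_involutionMatrix {w₁ w₂ e : F} (v : Fin 3 → F) :
    (involutionMatrix w₁ w₂ e).mulVec v = ![(1 + w₁ * w₂) * v 0 + w₁ ^ 2 * v 1,
      w₂ ^ 2 * v 0 + (1 + w₁ * w₂) * v 1, w₂ * e * v 0 + w₁ * e * v 1 + v 2] := by
  ext i
  fin_cases i <;> simp [involutionMatrix, Matrix.mulVec, dotProduct, Fin.sum_univ_three]

lemma form_mulVec_involutionMatrix [CharP F 2] {c : ConicParam F} {w₁ w₂ e : F}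
    (h : w₁ ^ 2 * c.α + (1 + w₁ * w₂) + w₂ ^ 2 * c.β = e ^ 2 * c.lam) (v : Fin 3 → F) :
    c.form ((involutionMatrix w₁ w₂ e).mulVec v) = c.form v := by
  have h2 : (2 : F) = 0 := two_eq_zero
  rw [mulVec_involutionMatrix]
  simp only [ConicParam.form, Matrix.cons_val_zero, Matrix.cons_val_one, Matrix.cons_val]
  grind

lemma det_involutionMatrix [CharP F 2] (w₁ w₂ e : F) : (involutionMatrix w₁ w₂ e).det = 1 := by
  have h2 : (2 : F) = 0 := two_eq_zero
  simp [involutionMatrix, Matrix.det_fin_three]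
  linear_combination w₁ * w₂ * h2

end Matrices

/-! ### Relations of a proper arc, and its stabilizer -/

section Stabilizer

variable {F : Type*} [Field F] [Finite F] [Algebra (ZMod 2) F] [CharP F 2]

/-- If `α` and `β` are affine functions of `lam` on a closed set, the conics belong to a pencil,
and a change of coordinates turns it into the standard one. -/
lemma isDennistonArc_of_affine {C : Set (ConicParam F)} (hC : IsClosedConicSet C)
    (h7 : C.ncard = 7) {a₀ a₁ b₀ b₁ : F}
    (hα : ∀ c ∈ C, c.α = a₀ + a₁ * c.lam) (hβ : ∀ c ∈ C, c.β = b₀ + b₁ * c.lam) :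
    IsDennistonArc (arcOf C) := by
  have h2 : (2 : F) = 0 := two_eq_zero
  obtain ⟨r, hr⟩ := exists_sq_eq a₁
  obtain ⟨q, hq⟩ := exists_sq_eq b₁
  obtain ⟨s, hs⟩ := exists_sq_eq b₀
  -- `Tr (α β)` is `Tr (a₀ b₀)` plus an additive function of `lam`
  have htr : Algebra.trace (ZMod 2) F (a₀ * b₀) = 1 := by
    have key : ∀ c ∈ C, Algebra.trace (ZMod 2) F (a₀ * b₀)
        + Algebra.trace (ZMod 2) F ((a₀ * b₁ + a₁ * b₀ + r * q) * c.lam) = 1 := by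
      intro c hc
      have e : a₀ * b₀ + (a₀ * b₁ + a₁ * b₀) * c.lam + (r * q * c.lam) ^ 2 = c.α * c.β := by
        rw [hα c hc, hβ c hc]
        linear_combination c.lam ^ 2 * (q ^ 2 * hr + a₁ * hq)
      have h1 := hC.trace_eq_one c hc
      rw [← e, map_add, map_add, trace_sq, add_assoc, ← map_add] at h1
      rw [← h1]
      congr 2
      ring
    obtain ⟨c, hc, d, hd, hcd⟩ := exists_two_members h7
    have k1 := key c hc
    have k2 := key d hd
    have k3 := key _ (hC.comp_mem c hc d hd hcd)
    have k4 : (c.comp d).lam = c.lam + d.lam := rfl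
    rw [k4, mul_add, map_add] at k3
    linear_combination k1 + k2 - k3
  have hs0 : s ≠ 0 := by
    rintro rfl
    rw [← hs] at htr
    simp at htr
  let M : Matrix (Fin 3) (Fin 3) F := !![s, 0, 0; 0, s⁻¹, 0; r * s, q * s⁻¹, 1]
  have hMdet : M.det ≠ 0 := by
    simp [M, Matrix.det_fin_three, hs0]
  obtain ⟨g, N, hN, hg⟩ := exists_isInducedBy M hMdet
  have hMv : ∀ v, N.1.mulVec v = ![s * v 0, s⁻¹ * v 1, r * s * v 0 + q * s⁻¹ * v 1 + v 2] := by
    intro v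
    rw [hN]
    ext i
    fin_cases i <;> simp [M, Matrix.mulVec, dotProduct, Fin.sum_univ_three]
  refine ⟨a₀ * b₀, lamSubgroup hC, htr, g, ⟨N, _, hg⟩, (image_arcOf hg ?_ ?_).symm⟩
  · intro v
    rw [hMv]
    simp [hs0]
  · intro v
    have hform : ∀ c ∈ C, c.form (N.1.mulVec v)
        = (⟨a₀ * b₀, 1, c.lam⟩ : ConicParam F).form v := by
      intro c hc
      rw [hMv]
      simp only [ConicParam.form, Matrix.cons_val_zero, Matrix.cons_val_one, Matrix.cons_val]
      rw [hα c hc, hβ c hc, ← hr, ← hq, ← hs]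
      field_simp
      grind
    constructor
    · rintro ⟨c, hc, h⟩
      exact ⟨⟨a₀ * b₀, 1, c.lam⟩, ⟨rfl, rfl, Or.inr ⟨c, hc, rfl⟩, hC.lam_ne_zero c hc⟩,
        (hform c hc).symm.trans h⟩
    · rintro ⟨⟨α, β, l⟩, ⟨hdα, hdβ, hl, hl0⟩, h⟩
      obtain ⟨c, hc, hcl⟩ := hl.resolve_left hl0
      simp only at hdα hdβ hcl
      subst hdα hdβ hcl
      exact ⟨c, hc, (hform c hc).trans h⟩

/-- The relations of the arc of a closed set form a space of dimension at most one, unless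
the arc is of Denniston type. -/
lemma relation_eq_smul {C : Set (ConicParam F)} (hC : IsClosedConicSet C)
    (h7 : C.ncard = 7) (hK : ¬ IsDennistonArc (arcOf C)) {u v w k u' v' w' k' : F}
    (hne : ¬ (u = 0 ∧ w = 0)) (h : HasRelation C u v w k) (h' : HasRelation C u' v' w' k') :
    ∃ t : F, u' = t * u ∧ v' = t * v ∧ w' = t * w ∧ k' = t * k := by
  have hdet : u * w' = u' * w := by
    by_contra hd
    obtain ⟨δ, hδ⟩ : ∃ δ, δ = u * w' - u' * w := ⟨_, rfl⟩
    have hδ0 : δ ≠ 0 := hδ ▸ sub_ne_zero.2 hd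
    apply hK
    refine isDennistonArc_of_affine hC h7 (a₀ := (w * v' - w' * v) / δ)
      (a₁ := (w' * k - w * k') / δ) (b₀ := (u' * v - u * v') / δ)
      (b₁ := (u * k' - u' * k) / δ) (fun c hc => ?_) (fun c hc => ?_)
    · field_simp
      linear_combination w' * h c hc - w * h' c hc + c.α * hδ
    · field_simp
      linear_combination u * h' c hc - u' * h c hc + c.β * hδ
  obtain ⟨t, hu, hw⟩ : ∃ t : F, u' = t * u ∧ w' = t * w := by
    by_cases hu : u = 0
    · have hw : w ≠ 0 := fun hw => hne ⟨hu, hw⟩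
      refine ⟨w' / w, ?_, by field_simp⟩
      field_simp
      linear_combination -hdet
    · refine ⟨u' / u, by field_simp, ?_⟩
      field_simp
      linear_combination hdet
  have h0 : HasRelation C 0 (v' - t * v) 0 (k' - t * k) := by
    intro c hc
    linear_combination h' c hc - t * h c hc - c.α * hu - c.β * hw
  obtain ⟨e1, e2⟩ := eq_zero_of_relation hC h7 h0
  exact ⟨t, hu, sub_eq_zero.1 e1, hw, sub_eq_zero.1 e2⟩

/-- The matrix entries of a linear collineation fixing each conic of a proper closed set: each
of the first two columns gives a relation, which is a multiple of the normalised one. -/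
lemma entries_eq_of_relations {C : Set (ConicParam F)} (hC : IsClosedConicSet C)
    (h7 : C.ncard = 7) (hK : ¬ IsDennistonArc (arcOf C)) {w₁ w₂ e : F}
    (hw : ¬ (w₁ = 0 ∧ w₂ = 0))
    (hrel : HasRelation C (w₁ ^ 2) (1 + w₁ * w₂) (w₂ ^ 2) (e ^ 2))
    {x₀ y₀ z₀ x₁ y₁ z₁ : F} (hdet : x₀ * y₁ + x₁ * y₀ = 1)
    (h₀ : ∀ c ∈ C, c.α * x₀ ^ 2 + x₀ * y₀ + c.β * y₀ ^ 2 + c.lam * z₀ ^ 2 = c.α)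
    (h₁ : ∀ c ∈ C, c.α * x₁ ^ 2 + x₁ * y₁ + c.β * y₁ ^ 2 + c.lam * z₁ ^ 2 = c.β) :
    !![x₀, x₁, 0; y₀, y₁, 0; z₀, z₁, 1] = 1 ∨
    !![x₀, x₁, 0; y₀, y₁, 0; z₀, z₁, 1] = involutionMatrix w₁ w₂ e := by
  have h2 : (2 : F) = 0 := two_eq_zero
  have hw' : ¬ (w₁ ^ 2 = 0 ∧ w₂ ^ 2 = 0) := by simpa using hw
  have hsq : ∀ {a b : F}, a ^ 2 = b ^ 2 → a = b := fun {a b} h => by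
    have h' : (a - b) ^ 2 = 0 := by linear_combination h + (b ^ 2 - a * b) * h2
    exact sub_eq_zero.1 (eq_zero_of_pow_eq_zero h')
  obtain ⟨t, a1, a2, a3, a4⟩ := relation_eq_smul hC h7 hK hw' hrel
    (u' := (x₀ + 1) ^ 2) (v' := x₀ * y₀) (w' := y₀ ^ 2) (k' := z₀ ^ 2) (fun c hc => by
      linear_combination h₀ c hc + (c.α * x₀ + c.α - c.lam * z₀ ^ 2) * h2)
  obtain ⟨t', b1, b2, b3, b4⟩ := relation_eq_smul hC h7 hK hw' hrel
    (u' := x₁ ^ 2) (v' := x₁ * y₁) (w' := (y₁ + 1) ^ 2) (k' := z₁ ^ 2) (fun c hc => by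
      linear_combination h₁ c hc + (c.β * y₁ + c.β - c.lam * z₁ ^ 2) * h2)
  obtain ⟨s, rfl⟩ := exists_sq_eq t
  obtain ⟨r, rfl⟩ := exists_sq_eq t'
  have hx₀ : x₀ = 1 + s * w₁ := by
    have := hsq (a := x₀ + 1) (b := s * w₁) (by rw [a1]; ring)
    linear_combination this - h2
  have hy₀ : y₀ = s * w₂ := hsq (by rw [a3]; ring)
  have hz₀ : z₀ = s * e := hsq (by rw [a4]; ring)
  have hx₁ : x₁ = r * w₁ := hsq (by rw [b1]; ring)
  have hy₁ : y₁ = 1 + r * w₂ := by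
    have := hsq (a := y₁ + 1) (b := r * w₂) (by rw [b3]; ring)
    linear_combination this - h2
  have hz₁ : z₁ = r * e := hsq (by rw [b4]; ring)
  subst hx₀ hy₀ hz₀ hx₁ hy₁ hz₁
  have hs : s * (s - w₂) = 0 := by linear_combination -a2
  have hr : r * (r - w₁) = 0 := by linear_combination -b2
  have hd : s * w₁ = r * w₂ := by
    linear_combination hdet - (r * w₂ + s * r * w₁ * w₂) * h2
  have hcase : (s = 0 ∧ r = 0) ∨ (s = w₂ ∧ r = w₁) := by
    rcases mul_eq_zero.1 hs with hs | hs <;> rcases mul_eq_zero.1 hr with hr | hr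
    · exact Or.inl ⟨hs, hr⟩
    · rw [sub_eq_zero] at hr
      rw [hs, hr, zero_mul, zero_eq_mul] at hd
      rcases hd with hd | hd
      · exact Or.inl ⟨hs, hr.trans hd⟩
      · exact Or.inr ⟨hs.trans hd.symm, hr⟩
    · rw [sub_eq_zero] at hs
      rw [hr, hs, zero_mul, mul_eq_zero] at hd
      rcases hd with hd | hd
      · exact Or.inl ⟨hs.trans hd, hr⟩
      · exact Or.inr ⟨hs, hr.trans hd.symm⟩
    · exact Or.inr ⟨sub_eq_zero.1 hs, sub_eq_zero.1 hr⟩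
  rcases hcase with ⟨rfl, rfl⟩ | ⟨rfl, rfl⟩
  · left
    ext i j
    fin_cases i <;> fin_cases j <;> simp
  · right
    ext i j
    fin_cases i <;> fin_cases j <;> simp [involutionMatrix] <;> ring

/-- A collineation stabilising the arc of a proper closed set of seven conics is induced by
a scalar multiple of the identity or of the involution matrix. -/
lemma eq_smul_of_stabilizes {p : ℕ} (hp : p.Prime) (hp2 : p ≠ 2) (hp3 : p ≠ 3) (hp7 : p ≠ 7)
    (hF : Nat.card F = 2 ^ p) {C : Set (ConicParam F)} (hC : IsClosedConicSet C)
    (h7 : C.ncard = 7) (hK : ¬ IsDennistonArc (arcOf C)) {w₁ w₂ e : F}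
    (hw : ¬ (w₁ = 0 ∧ w₂ = 0))
    (hrel : HasRelation C (w₁ ^ 2) (1 + w₁ * w₂) (w₂ ^ 2) (e ^ 2))
    {g : Equiv.Perm (Point F)} {M : GL (Fin 3) F} {σ : F ≃+* F} (hg : IsInducedBy g M σ)
    (hstab : ∀ P ∈ arcOf C, g P ∈ arcOf C) :
    σ = RingEquiv.refl F ∧ ∃ μ : F, μ ≠ 0 ∧
      (M.1 = μ • (1 : Matrix (Fin 3) (Fin 3) F) ∨ M.1 = μ • involutionMatrix w₁ w₂ e) := by
  have h32 : 32 ≤ Nat.card F := by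
    have h5 : 5 ≤ p := by
      have := hp.two_le
      have h4 : p ≠ 4 := by rintro rfl; revert hp; decide
      omega
    rw [hF]
    exact Nat.pow_le_pow_right (n := 2) (by norm_num) h5
  have hdet : M.1.det ≠ 0 := ((Matrix.isUnit_iff_isUnit_det _).1 M.isUnit).ne_zero
  have key : ∀ d ∈ C, _ := fun d hd =>
    exists_image_conic h32 h7 (d := d.map σ) (by simpa [ConicParam.map] using hC.lam_ne_zero d hd)
      M.1 hdet (fun w hw0 hform => by
        let v : Fin 3 → F := fun i => σ.symm (w i)
        have hwv : (fun i => σ (v i)) = w := by funext i; simp [v]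
        have hv : v ≠ 0 := by
          rintro hv
          apply hw0
          rw [← hwv, hv]
          funext i
          simp
        have hdv : d.form v = 0 := by
          rwa [← hwv, ConicParam.form_map, EmbeddingLike.map_eq_zero_iff] at hform
        obtain ⟨hne, e1⟩ := hg v hv
        have h1 := hstab _ ((mk_mem_arcOf C hv).2 (Or.inr ⟨d, hd, hdv⟩))
        rw [e1, mk_mem_arcOf, hwv] at h1
        exact h1)
  obtain ⟨d₀, hd₀, -⟩ := exists_two_members h7
  obtain ⟨h02, h12, h22, hD, -⟩ := key d₀ hd₀
  set D := M.1 0 0 * M.1 1 1 + M.1 0 1 * M.1 1 0 with hDdef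
  have hmap : ∀ x ∈ lamSubgroup hC, D / M.1 2 2 ^ 2 * σ x ∈ lamSubgroup hC := by
    rintro x (rfl | ⟨d, hd, rfl⟩)
    · rw [map_zero, mul_zero]
      exact zero_mem _
    · obtain ⟨-, -, -, -, c, hc, h1, -⟩ := key d hd
      refine Or.inr ⟨c, hc, ?_⟩
      have h1 : c.lam * M.1 2 2 ^ 2 = D * σ d.lam := h1
      field_simp
      exact h1
  have hcard : Nat.card (lamSubgroup hC) = 8 := by
    rw [card_lamSubgroup hC (Set.finite_of_ncard_ne_zero (by omega)), h7]
  obtain ⟨hσ, hk⟩ := eq_refl_and_eq_one_of_forall_mem hp hp2 hp3 hp7 hF (lamSubgroup hC) hcard σ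
    (div_ne_zero hD (pow_ne_zero 2 h22)) hmap
  have hDμ : D = M.1 2 2 ^ 2 := by rwa [div_eq_one_iff_eq (pow_ne_zero 2 h22)] at hk
  refine ⟨hσ, M.1 2 2, h22, ?_⟩
  -- since the parameters `lam` are preserved, every conic is fixed
  have hfix : ∀ c ∈ C,
      c.α * M.1 0 0 ^ 2 + M.1 0 0 * M.1 1 0 + c.β * M.1 1 0 ^ 2 + c.lam * M.1 2 0 ^ 2
        = D * c.α ∧
      c.α * M.1 0 1 ^ 2 + M.1 0 1 * M.1 1 1 + c.β * M.1 1 1 ^ 2 + c.lam * M.1 2 1 ^ 2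
        = D * c.β := by
    intro d hd
    obtain ⟨-, -, -, -, c, hc, h1, h2⟩ := key d hd
    rw [hσ] at h1 h2
    have h1 : c.lam * M.1 2 2 ^ 2 = D * d.lam := h1
    rw [hDμ, mul_comm] at h1
    have hcd : c = d := by
      by_contra hne
      exact hC.lam_ne c hc d hd hne (mul_left_cancel₀ (pow_ne_zero 2 h22) h1)
    subst hcd
    exact h2
  have hcases := entries_eq_of_relations hC h7 hK hw hrel
    (x₀ := M.1 0 0 / M.1 2 2) (y₀ := M.1 1 0 / M.1 2 2) (z₀ := M.1 2 0 / M.1 2 2)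
    (x₁ := M.1 0 1 / M.1 2 2) (y₁ := M.1 1 1 / M.1 2 2) (z₁ := M.1 2 1 / M.1 2 2)
    (by field_simp; rw [← hDμ]) (fun c hc => by
      have := (hfix c hc).1
      rw [hDμ] at this
      field_simp
      linear_combination this) (fun c hc => by
      have := (hfix c hc).2
      rw [hDμ] at this
      field_simp
      linear_combination this)
  have hM : M.1 = M.1 2 2 • !![M.1 0 0 / M.1 2 2, M.1 0 1 / M.1 2 2, 0;
      M.1 1 0 / M.1 2 2, M.1 1 1 / M.1 2 2, 0; M.1 2 0 / M.1 2 2, M.1 2 1 / M.1 2 2, 1] := by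
    ext i j
    fin_cases i <;> fin_cases j <;> simp [h02, h12, mul_div_cancel₀, h22]
  rcases hcases with h | h
  · left
    rw [h] at hM
    exact hM
  · right
    rw [h] at hM
    exact hM

lemma card_stabilizer_arcOf {p : ℕ} (hp : p.Prime) (hp2 : p ≠ 2) (hp3 : p ≠ 3) (hp7 : p ≠ 7)
    (hF : Nat.card F = 2 ^ p) {C : Set (ConicParam F)} (hC : IsClosedConicSet C)
    (h7 : C.ncard = 7) (hK : ¬ IsDennistonArc (arcOf C)) :
    Nat.card (collineationStabilizer (arcOf C)) = 2 := by
  obtain ⟨w₁, w₂, e, hw, hrel⟩ := exists_normalized_relation hC h7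
  obtain ⟨τ, T, hT, hτ⟩ := exists_isInducedBy (involutionMatrix w₁ w₂ e)
    (by rw [det_involutionMatrix]; exact one_ne_zero)
  have hτimg : τ '' arcOf C = arcOf C := by
    refine image_arcOf hτ (fun v => ?_) (fun v => ?_)
    · have h2 : (2 : F) = 0 := two_eq_zero
      rw [hT, mulVec_involutionMatrix]
      simp only [Matrix.cons_val_zero, Matrix.cons_val_one]
      constructor
      · rintro ⟨h0, h1⟩
        constructor
        · linear_combination (1 + w₁ * w₂) * h0 + w₁ ^ 2 * h1
            - (w₁ * w₂ * v 0 + w₁ ^ 2 * w₂ ^ 2 * v 0 + w₁ ^ 2 * v 1 + w₁ ^ 3 * w₂ * v 1) * h2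
        · linear_combination w₂ ^ 2 * h0 + (1 + w₁ * w₂) * h1
            - (w₁ * w₂ * v 1 + w₁ ^ 2 * w₂ ^ 2 * v 1 + w₂ ^ 2 * v 0 + w₂ ^ 3 * w₁ * v 0) * h2
      · rintro ⟨h0, h1⟩
        simp [h0, h1]
    · refine exists_congr fun c => and_congr_right fun hc => ?_
      rw [hT, form_mulVec_involutionMatrix (hrel c hc)]
  let τ' : collineationStabilizer (arcOf C) := ⟨⟨τ, T, _, hτ⟩, hτimg⟩
  have hne : (1 : collineationStabilizer (arcOf C)) ≠ τ' := by
    intro h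
    have h1 : τ = 1 := congrArg (fun x => x.1.1) h.symm
    -- the points `(1, 0, 0)` and `(0, 1, 0)` are not both fixed
    have hfix : ∀ v : Fin 3 → F, v ≠ 0 → ∃ a : F, a • v = T.1.mulVec v := by
      intro v hv
      obtain ⟨hw', e1⟩ := hτ v hv
      rw [h1, Equiv.Perm.one_apply] at e1
      exact (Projectivization.mk_eq_mk_iff' F _ _ hw' hv).1 e1.symm
    apply hw
    constructor
    · obtain ⟨a, ha⟩ := hfix ![0, 1, 0] (fun h => one_ne_zero (congrFun h 1))
      rw [hT, mulVec_involutionMatrix] at ha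
      have := congrFun ha 0
      simpa using this.symm
    · obtain ⟨a, ha⟩ := hfix ![1, 0, 0] (fun h => one_ne_zero (congrFun h 0))
      rw [hT, mulVec_involutionMatrix] at ha
      have := congrFun ha 1
      simpa using this.symm
  rw [Nat.card_eq_two_iff]
  refine ⟨1, τ', hne, ?_⟩
  rw [Set.eq_univ_iff_forall]
  rintro ⟨⟨g, M, σ, hg⟩, hgs⟩
  have hstab : ∀ P ∈ arcOf C, g P ∈ arcOf C := by
    intro P hP
    have h1 : g '' arcOf C = arcOf C := hgs
    rw [← h1]
    exact ⟨P, hP, rfl⟩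
  obtain ⟨rfl, μ, hμ, hM⟩ := eq_smul_of_stabilizes hp hp2 hp3 hp7 hF hC h7 hK hw hrel hg hstab
  rcases hM with hM | hM
  · left
    apply Subtype.ext
    apply Subtype.ext
    ext P
    induction P using Projectivization.ind with
    | h v hv =>
      refine (hg.apply_of_eq_smul hM hv (by rwa [Matrix.one_mulVec])).trans ?_
      simp only [Matrix.one_mulVec]
      rfl
  · right
    apply Subtype.ext
    apply Subtype.ext
    ext P
    induction P using Projectivization.ind with
    | h v hv =>
      obtain ⟨hw', e1⟩ := hτ v hv
      have h1 : (involutionMatrix w₁ w₂ e).mulVec v ≠ 0 := by rw [← hT]; exact hw'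
      exact (hg.apply_of_eq_smul hM hv h1).trans
        (hτ.apply_of_eq_smul (μ := 1) (by rw [one_smul, hT]) hv h1).symm

end Stabilizer

end MathonArcs

theorem corollaryC2 (p : ℕ) (hp : p.Prime) (hp2 : p ≠ 2) (hp3 : p ≠ 3) (hp7 : p ≠ 7)
    (F : Type*) [Field F] [Finite F] [Algebra (ZMod 2) F] (hF : Nat.card F = 2 ^ p)
    (K : Set (MathonArcs.Point F)) (hK : MathonArcs.IsProperMathonArc 8 K) :
    IsCyclic (MathonArcs.collineationStabilizer K) ∧
      Nat.card (MathonArcs.collineationStabilizer K) = 2 := by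
  have : CharP F 2 := charP_of_injective_algebraMap (algebraMap (ZMod 2) F).injective 2
  have : Fact (Nat.Prime 2) := ⟨Nat.prime_two⟩
  suffices h : Nat.card (MathonArcs.collineationStabilizer K) = 2 from
    ⟨isCyclic_of_prime_card h, h⟩
  obtain ⟨⟨C, hC, h8, g, hg, hKg⟩, hnot⟩ := hK
  have hsmul : K = (⟨g, hg⟩ : MathonArcs.collineationGroup F) • MathonArcs.arcOf C := hKg
  rw [← MathonArcs.card_stabilizer_arcOf hp hp2 hp3 hp7 hF hC (by omega) ?_]
  · exact (Nat.card_congr (MulAction.stabilizerEquivStabilizer hsmul).toEquiv).symm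
  · rintro ⟨α, A, hα, g', hg', h⟩
    refine hnot ⟨α, A, hα, g * g', mul_mem hg hg', ?_⟩
    rw [hKg, h, ← Set.image_comp]
    rfl
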